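/- Let $n,t\ge 1$ be integers and let $(\mathbf S_\gamma)_{\gamma\in\mathbb N_0^n}$ be a family of real symmetric $t\times t$ matrices. A matrix-valued measure on $\mathbb R^n$ is a matrix $\mathbf E=(\sigma_{ij})_{i,j=1}^t$ of finite signed Borel measures on $\mathbb R^n$; its support is the union of the supports of the $\sigma_{ij}$ (the support of a signed measure being that of its total variation), it is positive semidefinite if $\sigma_{ij}=\sigma_{ji}$ for all $i,j$ and $v^T\mathbf E(A)v\ge 0$ for all Borel sets $A\subseteq\mathbb R^n$ and all $v\in\mathbb R^t$, and $\int f\,d\mathbf E:=(\int f\,d\sigma_{ij})_{i,j}$. The family $(\mathbf S_\gamma)$ is called a matrix-valued $[-1,1]^n$-moment sequence if there is a positive semidefinite matrix-valued measure $\mathbf E$ on $\mathbb R^n$ with support contained in $[-1,1]^n$ such that $\mathbf S_\gamma=\int x_1^{\gamma_1}\cdots x_n^{\gamma_n}\,d\mathbf E(x)$ for every $\gamma\in\mathbb N_0^n$ (all these integrals being absolutely convergent). For $\alpha,\beta\in\mathbb N_0^{2n}$ write $\beta\le\alpha$ if $\beta_k\le\alpha_k$ for all $k$, and put $\binom{\alpha}{\beta}=\prod_{k=1}^{2n}\binom{\alpha_k}{\beta_k}$,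 $e(\beta)=\sum_{i=1}^n\beta_{2i}$ and $\pi(\beta)=(\beta_1+\beta_2,\beta_3+\beta_4,\dots,\beta_{2n-1}+\beta_{2n})\in\mathbb N_0^n$. Then $(\mathbf S_\gamma)_{\gamma\in\mathbb N_0^n}$ is a matrix-valued $[-1,1]^n$-moment sequence if and only if $$\sum_{\beta\in\mathbb N_0^{2n},\ \beta\le\alpha}(-1)^{e(\beta)}\binom{\alpha}{\beta}\operatorname{tr}\bigl(\mathbf G\,\mathbf S_{\pi(\beta)}\bigr)\ \ge\ 0$$ for all (symmetric) positive definite matrices $\mathbf G\in M_t(\mathbb R)$ and all $\alpha\in\mathbb N_0^{2n}$. -/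

import Mathlib

open scoped Matrix

noncomputable section

/-- A `t × t` matrix-valued measure on `ℝⁿ`: a `t × t` array `(σ i j)` of finite signed Borel
measures on `ℝⁿ`. -/
abbrev MatrixMeasure (n t : ℕ) : Type :=
  Fin t → Fin t → MeasureTheory.SignedMeasure (Fin n → ℝ)

namespace MatrixMeasure

variable {n t : ℕ}

/-- The matrix `E(A) = (σ i j (A))`. -/
def value (E : MatrixMeasure n t) (A : Set (Fin n → ℝ)) : Matrix (Fin t) (Fin t) ℝ :=
  Matrix.of fun i j => E i j A

/-- `E` is positive semidefinite: `σ i j = σ j i` for all `i, j`, and `vᵀ E(A) v ≥ 0` for every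
Borel set `A` and every vector `v`. -/
def IsPosSemidef (E : MatrixMeasure n t) : Prop :=
  (∀ i j, E i j = E j i) ∧
    ∀ A : Set (Fin n → ℝ), MeasurableSet A → ∀ v : Fin t → ℝ, 0 ≤ v ⬝ᵥ (E.value A *ᵥ v)

/-- The support of `E`: the union of the (closed) supports of the entries, the support of a signed
measure being the support of its total variation. -/
def support (E : MatrixMeasure n t) : Set (Fin n → ℝ) :=
  ⋃ i, ⋃ j, (E i j).variation.support

/-- `f` is integrable with respect to every entry of `E`. -/
def Integrable (E : MatrixMeasure n t) (f : (Fin n → ℝ) → ℝ) : Prop :=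
  ∀ i j, (E i j).Integrable f

/-- The matrix-valued integral `∫ f dE = (∫ f dσ i j)`. -/
def integral (E : MatrixMeasure n t) (f : (Fin n → ℝ) → ℝ) : Matrix (Fin t) (Fin t) ℝ :=
  Matrix.of fun i j => ∫ᵛ x, f x ∂<•(E i j)

end MatrixMeasure

/-- `S` is a matrix-valued `K`-moment sequence: there is a positive semidefinite matrix-valued
measure `E` on `ℝⁿ` with support in `K` such that `S α = ∫ x ^ α dE(x)` for every multi-index `α`
(the integrals being convergent). -/
def IsMatrixMomentSequence {n t : ℕ} (K : Set (Fin n → ℝ))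
    (S : (Fin n → ℕ) → Matrix (Fin t) (Fin t) ℝ) : Prop :=
  ∃ E : MatrixMeasure n t, E.IsPosSemidef ∧ E.support ⊆ K ∧
    ∀ α : Fin n → ℕ, E.Integrable (fun x => ∏ i, x i ^ α i) ∧
      S α = E.integral (fun x => ∏ i, x i ^ α i)

/-- The hypercube `[-1,1]ⁿ`. -/
def hypercube (n : ℕ) : Set (Fin n → ℝ) := {x | ∀ i, x i ∈ Set.Icc (-1 : ℝ) 1}

/-- Position `2i - 1` of a `2n`-tuple, for `i = 1, …, n` (written with indices from `0`). -/
def oddPos {n : ℕ} (i : Fin n) : Fin (2 * n) := ⟨2 * i.val, by have := i.isLt; omega⟩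

/-- Position `2i` of a `2n`-tuple, for `i = 1, …, n` (written with indices from `0`). -/
def evenPos {n : ℕ} (i : Fin n) : Fin (2 * n) := ⟨2 * i.val + 1, by have := i.isLt; omega⟩

/-- `e(β) = β₂ + β₄ + ⋯ + β₂ₙ`. -/
def evenSum {n : ℕ} (β : Fin (2 * n) → ℕ) : ℕ := ∑ i : Fin n, β (evenPos i)

/-- The multi-index `(β₁ + β₂, β₃ + β₄, …, β₂ₙ₋₁ + β₂ₙ)`. -/
def pairSum {n : ℕ} (β : Fin (2 * n) → ℕ) : Fin n → ℕ :=
  fun i => β (oddPos i) + β (evenPos i)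

/-- `binom(α, β) = ∏ₖ binom(αₖ, βₖ)`. -/
def multiChoose {m : ℕ} (α β : Fin m → ℕ) : ℕ := ∏ k, (α k).choose (β k)

end

/-! The alternating sum for `α` is `L_G (∏ᵢ (1 + Xᵢ)^α₂ᵢ₋₁ (1 - Xᵢ)^α₂ᵢ)`, where `L_G` is the linear
functional sending `X^γ` to `tr (G S_γ)`. Necessity: `tr (G E)` is a nonnegative scalar measure on
the cube, where these products are nonnegative.

Sufficiency starts from the scalar case, `exists_measure_of_nonneg_on_bernsteinMonoid`. The
normalized functionals nonnegative on products of `(1 ± Xᵢ)/2` form a compact convex set whose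
extreme points are evaluations at points of the cube (`exists_eval_of_mem_extremePoints`), so
Krein–Milman yields representing measures. Letting `G` tend to `v vᵀ` gives a measure `μ v` for each
form `vᵀ S v`. Polarization defines the matrix entries. Since polynomial integrals determine a
signed measure on the cube (`signedMeasure_hypercube_ext`), the identity `vᵀ E v = μ v` passes from
moments to measures and makes `E` positive semidefinite. -/

open MvPolynomial MeasureTheory

/-! ### Bounds for functionals nonnegative on the Bernstein monoid -/

/-- The affine polynomials `(1 ± Xᵢ) / 2`, which take values in `[0, 1]` on the hypercube. -/
def unitIntervalGenerators (n : ℕ) : Set (MvPolynomial (Fin n) ℝ) :=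
  {g | ∃ i, g = C (1 / 2) * (1 + X i) ∨ g = C (1 / 2) * (1 - X i)}

/-- The multiplicative monoid of products of the polynomials `(1 ± Xᵢ) / 2`. -/
noncomputable def bernsteinMonoid (n : ℕ) : Submonoid (MvPolynomial (Fin n) ℝ) :=
  Submonoid.closure (unitIntervalGenerators n)

theorem one_sub_mem_unitIntervalGenerators {n : ℕ} {g : MvPolynomial (Fin n) ℝ}
    (hg : g ∈ unitIntervalGenerators n) : 1 - g ∈ unitIntervalGenerators n := by
  have h : (1 : MvPolynomial (Fin n) ℝ) = C (1 / 2) + C (1 / 2) := by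
    rw [← C_add]; norm_num
  obtain ⟨i, rfl | rfl⟩ := hg
  · exact ⟨i, Or.inr (by linear_combination h)⟩
  · exact ⟨i, Or.inl (by linear_combination h)⟩

theorem span_bernsteinMonoid (n : ℕ) :
    Submodule.span ℝ (bernsteinMonoid n : Set (MvPolynomial (Fin n) ℝ)) = ⊤ := by
  rw [bernsteinMonoid, ← Algebra.adjoin_eq_span, ← Algebra.top_toSubmodule]
  refine congrArg Subalgebra.toSubmodule ?_
  rw [← top_le_iff, ← MvPolynomial.adjoin_range_X]
  refine Algebra.adjoin_le ?_
  rintro _ ⟨i, rfl⟩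
  have h1 : C (1 / 2) * (1 + X i) ∈ Algebra.adjoin ℝ (unitIntervalGenerators n) :=
    Algebra.subset_adjoin ⟨i, Or.inl rfl⟩
  have h2 : C (1 / 2) * (1 - X i) ∈ Algebra.adjoin ℝ (unitIntervalGenerators n) :=
    Algebra.subset_adjoin ⟨i, Or.inr rfl⟩
  have h : (1 : MvPolynomial (Fin n) ℝ) = C (1 / 2) + C (1 / 2) := by
    rw [← C_add]; norm_num
  have h3 := Subalgebra.sub_mem _ h1 h2
  have h4 : (C (1 / 2) * (1 + X i) - C (1 / 2) * (1 - X i) : MvPolynomial (Fin n) ℝ) = X i := by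
    linear_combination -X i * h
  rwa [h4] at h3

section PositiveFunctional

variable {n : ℕ} {φ : MvPolynomial (Fin n) ℝ →ₗ[ℝ] ℝ}

/-- For a generator `g`, `m' - m' g = m' (1 - g)` lies in the monoid again; this is why the
generators carry the factor `1/2`. A general `m` is absorbed one factor at a time. -/
theorem apply_mul_le_of_mem_bernsteinMonoid (hφ : ∀ m ∈ bernsteinMonoid n, 0 ≤ φ m)
    {m m' : MvPolynomial (Fin n) ℝ} (hm : m ∈ bernsteinMonoid n) (hm' : m' ∈ bernsteinMonoid n) :
    φ (m' * m) ≤ φ m' := by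
  induction hm using Submonoid.closure_induction generalizing m' with
  | mem g hg =>
    have := hφ _ (mul_mem hm' (Submonoid.subset_closure (one_sub_mem_unitIntervalGenerators hg)))
    rw [mul_sub, mul_one, map_sub] at this
    linarith
  | one => simp
  | mul x y hx hy ihx ihy =>
    rw [← mul_assoc]
    exact (ihy (mul_mem hm' hx)).trans (ihx hm')

theorem apply_le_of_mem_bernsteinMonoid (hφ : ∀ m ∈ bernsteinMonoid n, 0 ≤ φ m)
    {m : MvPolynomial (Fin n) ℝ} (hm : m ∈ bernsteinMonoid n) : φ m ≤ φ 1 := by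
  simpa using apply_mul_le_of_mem_bernsteinMonoid hφ hm (one_mem _)

/-- For `x` in the monoid, `0 ≤ φ (m x) ≤ φ m = 0`, and the monoid spans all polynomials. -/
theorem apply_mul_eq_zero_of_mem_bernsteinMonoid (hφ : ∀ m ∈ bernsteinMonoid n, 0 ≤ φ m)
    {m : MvPolynomial (Fin n) ℝ} (hm : m ∈ bernsteinMonoid n) (h0 : φ m = 0)
    (p : MvPolynomial (Fin n) ℝ) : φ (m * p) = 0 := by
  have hp : p ∈ Submodule.span ℝ (bernsteinMonoid n : Set (MvPolynomial (Fin n) ℝ)) := by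
    rw [span_bernsteinMonoid]; trivial
  induction hp using Submodule.span_induction with
  | mem x hx =>
    exact le_antisymm (h0 ▸ apply_mul_le_of_mem_bernsteinMonoid hφ hx hm) (hφ _ (mul_mem hm hx))
  | zero => simp
  | add x y _ _ hx hy => rw [mul_add, map_add, hx, hy, add_zero]
  | smul a x _ hx => rw [mul_smul_comm, map_smul, hx, smul_zero]

theorem eq_zero_of_apply_one_eq_zero (hφ : ∀ m ∈ bernsteinMonoid n, 0 ≤ φ m) (h0 : φ 1 = 0) :
    φ = 0 := by
  refine LinearMap.ext fun p => ?_
  simpa using apply_mul_eq_zero_of_mem_bernsteinMonoid hφ (one_mem _) h0 _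

/-- The bound does not depend on `φ`, which is what Tychonoff's theorem needs. -/
theorem exists_bound_apply (p : MvPolynomial (Fin n) ℝ) :
    ∃ B : ℝ, ∀ φ : MvPolynomial (Fin n) ℝ →ₗ[ℝ] ℝ,
      (∀ m ∈ bernsteinMonoid n, 0 ≤ φ m) → φ 1 = 1 → |φ p| ≤ B := by
  have hp : p ∈ Submodule.span ℝ (bernsteinMonoid n : Set (MvPolynomial (Fin n) ℝ)) := by
    rw [span_bernsteinMonoid]; trivial
  induction hp using Submodule.span_induction with
  | mem x hx =>
    exact ⟨1, fun φ hφ h1 => by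
      rw [abs_of_nonneg (hφ x hx), ← h1]; exact apply_le_of_mem_bernsteinMonoid hφ hx⟩
  | zero => exact ⟨0, by simp⟩
  | add x y _ _ hx hy =>
    obtain ⟨A, hA⟩ := hx
    obtain ⟨B, hB⟩ := hy
    refine ⟨A + B, fun φ hφ h1 => ?_⟩
    rw [map_add]
    exact (abs_add_le _ _).trans (add_le_add (hA φ hφ h1) (hB φ hφ h1))
  | smul a x _ hx =>
    obtain ⟨A, hA⟩ := hx
    refine ⟨|a| * A, fun φ hφ h1 => ?_⟩
    rw [map_smul, smul_eq_mul, abs_mul]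
    exact mul_le_mul_of_nonneg_left (hA φ hφ h1) (abs_nonneg _)

end PositiveFunctional

/-! ### The state space and its extreme points -/

/-- The normalized linear functionals on polynomials that are nonnegative on the products of the
polynomials `(1 ± Xᵢ) / 2`, as a subset of the space of all functions. -/
def bernsteinStates (n : ℕ) : Set (MvPolynomial (Fin n) ℝ → ℝ) :=
  {f | ∃ φ : MvPolynomial (Fin n) ℝ →ₗ[ℝ] ℝ,
    (∀ m ∈ bernsteinMonoid n, 0 ≤ φ m) ∧ φ 1 = 1 ∧ ⇑φ = f}

theorem bernsteinStates_eq (n : ℕ) : bernsteinStates n =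
    (⋂ p, ⋂ q, {f | f (p + q) = f p + f q}) ∩ (⋂ c : ℝ, ⋂ p, {f | f (c • p) = c * f p}) ∩
      (⋂ m ∈ bernsteinMonoid n, {f | 0 ≤ f m}) ∩ {f | f 1 = 1} := by
  ext f
  simp only [bernsteinStates, Set.mem_ofPred_eq, Set.mem_inter_iff, Set.mem_iInter]
  constructor
  · rintro ⟨φ, h, h1, rfl⟩
    exact ⟨⟨⟨map_add φ, fun c p => map_smul φ c p⟩, h⟩, h1⟩
  · rintro ⟨⟨⟨ha, hs⟩, h⟩, h1⟩
    exact ⟨⟨⟨f, ha⟩, hs⟩, h, h1, rfl⟩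

theorem isCompact_bernsteinStates (n : ℕ) : IsCompact (bernsteinStates n) := by
  choose B hB using exists_bound_apply (n := n)
  refine IsCompact.of_isClosed_subset
    (isCompact_univ_pi fun p => isCompact_Icc (a := -B p) (b := B p)) ?_ ?_
  · rw [bernsteinStates_eq]
    refine ((IsClosed.inter ?_ ?_).inter ?_).inter ?_
    · exact isClosed_iInter fun p => isClosed_iInter fun q =>
        isClosed_eq (by fun_prop) (by fun_prop)
    · exact isClosed_iInter fun p => isClosed_iInter fun q =>
        isClosed_eq (by fun_prop) (by fun_prop)
    · exact isClosed_iInter fun p => isClosed_iInter fun _ =>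
        isClosed_le (by fun_prop) (by fun_prop)
    · exact isClosed_eq (by fun_prop) (by fun_prop)
  · rintro _ ⟨φ, h, h1, rfl⟩ p -
    exact abs_le.1 (hB p φ h h1)

theorem convex_bernsteinStates (n : ℕ) : Convex ℝ (bernsteinStates n) := by
  rintro _ ⟨φ, h, h1, rfl⟩ _ ⟨ψ, k, k1, rfl⟩ a b ha hb hab
  refine ⟨a • φ + b • ψ, fun m hm => ?_, ?_, rfl⟩
  · have := h m hm
    have := k m hm
    simp only [LinearMap.add_apply, LinearMap.smul_apply, smul_eq_mul]
    positivity
  · simp [h1, k1, hab]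

/-- With `c = φ g` strictly between 0 and 1, `φ` is the convex combination, with weights `c` and `1
- c`, of the states `p ↦ φ (g p) / c` and `p ↦ φ ((1 - g) p) / (1 - c)`. Extremality forces the
first to equal `φ`. -/
theorem apply_mul_of_mem_extremePoints {n : ℕ} {φ : MvPolynomial (Fin n) ℝ →ₗ[ℝ] ℝ}
    (hφ : ⇑φ ∈ (bernsteinStates n).extremePoints ℝ) {g : MvPolynomial (Fin n) ℝ}
    (hg : g ∈ unitIntervalGenerators n) (p : MvPolynomial (Fin n) ℝ) :
    φ (g * p) = φ g * φ p := by
  obtain ⟨⟨φ', h, h1, hφ'⟩, hext⟩ := mem_extremePoints_iff_left.1 hφ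
  obtain rfl : φ' = φ := DFunLike.coe_injective hφ'
  have hgM : g ∈ bernsteinMonoid n := Submonoid.subset_closure hg
  have hgM' : 1 - g ∈ bernsteinMonoid n :=
    Submonoid.subset_closure (one_sub_mem_unitIntervalGenerators hg)
  have hc0 := h g hgM
  have hc1 := h _ hgM'
  have hsub : ∀ q, φ' ((1 - g) * q) = φ' q - φ' (g * q) := fun q => by
    rw [sub_mul, one_mul, map_sub]
  have hg' : φ' (1 - g) = 1 - φ' g := by rw [map_sub, h1]
  -- If `φ g` is 0 or 1, one of the two states is undefined; then `φ` vanishes on all multiples of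
  -- `g` or of `1 - g`.
  rcases hc0.eq_or_lt with hc | hc
  · rw [apply_mul_eq_zero_of_mem_bernsteinMonoid h hgM hc.symm, ← hc, zero_mul]
  rcases hc1.eq_or_lt with hd | hd
  · have := apply_mul_eq_zero_of_mem_bernsteinMonoid h hgM' hd.symm p
    rw [hsub] at this
    have h2 : φ' g = 1 := by linarith
    rw [h2]; linarith
  have key := hext ((φ' g)⁻¹ • φ' ∘ₗ LinearMap.mulLeft ℝ g : MvPolynomial (Fin n) ℝ →ₗ[ℝ] ℝ)
    ⟨_, fun m hm => ?_, ?_, rfl⟩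
    ((φ' (1 - g))⁻¹ • φ' ∘ₗ LinearMap.mulLeft ℝ (1 - g) : MvPolynomial (Fin n) ℝ →ₗ[ℝ] ℝ)
    ⟨_, fun m hm => ?_, ?_, rfl⟩ ⟨φ' g, φ' (1 - g), hc, hd, by rw [hg']; ring, ?_⟩
  · have := congrFun key p
    simp only [LinearMap.smul_apply, LinearMap.comp_apply, LinearMap.mulLeft_apply,
      smul_eq_mul] at this
    rw [← this]
    field_simp
  · simpa using mul_nonneg (inv_nonneg.2 hc0) (h _ (mul_mem hgM hm))
  · simp [hc.ne']
  · simpa using mul_nonneg (inv_nonneg.2 hc1) (h _ (mul_mem hgM' hm))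
  · simp only [LinearMap.smul_apply, LinearMap.comp_apply, LinearMap.mulLeft_apply,
      smul_eq_mul, mul_one]
    exact inv_mul_cancel₀ hd.ne'
  · funext q
    simp only [Pi.add_apply, Pi.smul_apply, LinearMap.smul_apply, LinearMap.comp_apply,
      LinearMap.mulLeft_apply, smul_eq_mul]
    rw [mul_inv_cancel_left₀ hc.ne', mul_inv_cancel_left₀ hd.ne', hsub]
    ring

theorem exists_eval_of_mem_extremePoints {n : ℕ} {f : MvPolynomial (Fin n) ℝ → ℝ}
    (hf : f ∈ (bernsteinStates n).extremePoints ℝ) :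
    ∃ x ∈ hypercube n, ∀ p, f p = eval x p := by
  obtain ⟨φ, h, h1, rfl⟩ := hf.1
  have hp : ∀ i, φ (C (1 / 2) * (1 + X i)) = (1 + φ (X i)) / 2 := fun i => by
    rw [C_mul', map_smul, map_add, h1, smul_eq_mul]; ring
  have hm : ∀ i, φ (C (1 / 2) * (1 - X i)) = (1 - φ (X i)) / 2 := fun i => by
    rw [C_mul', map_smul, map_sub, h1, smul_eq_mul]; ring
  refine ⟨fun i => φ (X i), fun i => ?_, fun p => ?_⟩
  · have h2 := h _ (Submonoid.subset_closure ⟨i, Or.inl rfl⟩)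
    have h3 := h _ (Submonoid.subset_closure ⟨i, Or.inr rfl⟩)
    rw [hp] at h2
    rw [hm] at h3
    constructor <;> linarith
  · induction p using MvPolynomial.induction_on with
    | C a => rw [← mul_one (C a), C_mul', map_smul, h1]; simp
    | add p q hp hq => rw [map_add, hp, hq, map_add]
    | mul_X p i hq =>
      have := apply_mul_of_mem_extremePoints hf ⟨i, Or.inl rfl⟩ p
      rw [hp, mul_assoc, C_mul', map_smul, add_mul, one_mul, map_add, smul_eq_mul] at this
      rw [mul_comm p, RingHom.map_mul, eval_X, ← hq]
      linarith

/-! ### Representing measures on the cube and their uniqueness -/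

instance (n : ℕ) : CompactSpace (hypercube n) := by
  refine isCompact_iff_compactSpace.1 ?_
  have : hypercube n = Set.univ.pi fun _ => Set.Icc (-1 : ℝ) 1 := by
    ext x; simp [hypercube, -Set.pi_univ_Icc]
  rw [this]
  exact isCompact_univ_pi fun _ => isCompact_Icc

/-- A polynomial as a continuous function on the hypercube. -/
noncomputable def polyOnCube {n : ℕ} : MvPolynomial (Fin n) ℝ →ₐ[ℝ] C(hypercube n, ℝ) :=
  aeval fun i => ⟨fun x => x.1 i, (continuous_apply i).comp continuous_subtype_val⟩

@[simp]
theorem polyOnCube_apply {n : ℕ} (p : MvPolynomial (Fin n) ℝ) (x : hypercube n) :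
    polyOnCube p x = eval x.1 p := by
  induction p using MvPolynomial.induction_on with
  | C a => simp [polyOnCube]
  | add p q hp hq => simp [hp, hq]
  | mul_X p i hp => simp [hp]; simp [polyOnCube]

theorem integrable_eval_hypercube {n : ℕ} (μ : Measure (hypercube n)) [IsFiniteMeasure μ]
    (p : MvPolynomial (Fin n) ℝ) : Integrable (fun x : hypercube n => eval x.1 p) μ := by
  have h := (polyOnCube p).continuous.integrable_of_hasCompactSupport (μ := μ)
    (HasCompactSupport.of_compactSpace _)
  exact h.congr (Filter.Eventually.of_forall fun x => polyOnCube_apply p x)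

/-- Krein–Milman: the right-hand set contains the extreme points (Dirac measures), is convex, and is
closed as a continuous image of the weakly compact space of probability measures on the cube. -/
theorem bernsteinStates_subset_range_integral (n : ℕ) : bernsteinStates n ⊆
    Set.range fun (μ : ProbabilityMeasure (hypercube n)) (p : MvPolynomial (Fin n) ℝ) =>
      ∫ x, eval x.1 p ∂(μ : Measure (hypercube n)) := by
  rw [← closure_convexHull_extremePoints (isCompact_bernsteinStates n) (convex_bernsteinStates n)]
  refine closure_minimal (convexHull_min ?_ ?_) ?_
  · intro f hf
    obtain ⟨x, hx, h⟩ := exists_eval_of_mem_extremePoints hf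
    refine ⟨⟨Measure.dirac ⟨x, hx⟩, inferInstance⟩, ?_⟩
    funext p
    simp [h]
  · rintro _ ⟨μ, rfl⟩ _ ⟨ν, rfl⟩ a b ha hb hab
    have : IsProbabilityMeasure (ENNReal.ofReal a • (μ : Measure (hypercube n)) +
        ENNReal.ofReal b • (ν : Measure (hypercube n))) :=
      ⟨by simp [← ENNReal.ofReal_add ha hb, hab]⟩
    refine ⟨⟨_, this⟩, ?_⟩
    funext p
    change ∫ x, eval x.1 p ∂(ENNReal.ofReal a • (μ : Measure (hypercube n)) +
        ENNReal.ofReal b • (ν : Measure (hypercube n))) = _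
    rw [integral_add_measure
      ((integrable_eval_hypercube _ p).smul_measure ENNReal.ofReal_ne_top)
      ((integrable_eval_hypercube _ p).smul_measure ENNReal.ofReal_ne_top),
      integral_smul_measure, integral_smul_measure, ENNReal.toReal_ofReal ha,
      ENNReal.toReal_ofReal hb]
    rfl
  · refine (isCompact_range (continuous_pi fun p => ?_)).isClosed
    simpa using ProbabilityMeasure.continuous_integral_continuousMap (polyOnCube p)

/-- A linear functional on polynomials that is nonnegative on all products of the polynomials
`(1 ± Xᵢ) / 2` is integration against a finite measure on the hypercube. -/
theorem exists_measure_of_nonneg_on_bernsteinMonoid {n : ℕ}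
    (φ : MvPolynomial (Fin n) ℝ →ₗ[ℝ] ℝ) (hφ : ∀ m ∈ bernsteinMonoid n, 0 ≤ φ m) :
    ∃ μ : Measure (hypercube n), IsFiniteMeasure μ ∧ ∀ p, φ p = ∫ x, eval x.1 p ∂μ := by
  rcases (hφ 1 (one_mem _)).eq_or_lt with h0 | h0
  · exact ⟨0, inferInstance, by simp [eq_zero_of_apply_one_eq_zero hφ h0.symm]⟩
  · have hmem : ⇑((φ 1)⁻¹ • φ) ∈ bernsteinStates n :=
      ⟨(φ 1)⁻¹ • φ, fun m hm => mul_nonneg (inv_nonneg.2 h0.le) (hφ m hm),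
        inv_mul_cancel₀ h0.ne', rfl⟩
    obtain ⟨μ, hμ⟩ := bernsteinStates_subset_range_integral n hmem
    refine ⟨ENNReal.ofReal (φ 1) • (μ : Measure (hypercube n)),
      Measure.smul_finite _ ENNReal.ofReal_ne_top, fun p => ?_⟩
    have := congrFun hμ p
    dsimp only at this
    rw [integral_smul_measure, this, ENNReal.toReal_ofReal h0.le]
    simp [h0.ne']

/-- Polynomials form an algebra separating the points of the cube, hence determine finite measures.
-/
theorem measure_hypercube_ext {n : ℕ} {μ ν : Measure (hypercube n)} [IsFiniteMeasure μ]
    [IsFiniteMeasure ν]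
    (h : ∀ p : MvPolynomial (Fin n) ℝ, ∫ x, eval x.1 p ∂μ = ∫ x, eval x.1 p ∂ν) : μ = ν := by
  let A : StarSubalgebra ℝ (BoundedContinuousFunction (hypercube n) ℝ) :=
    { (polyOnCube (n := n)).range.comap (BoundedContinuousFunction.toContinuousMapₐ ℝ) with
      star_mem' := fun {a} ha => by rwa [show star a = a from rfl] }
  refine ext_of_forall_mem_subalgebra_integral_eq_of_pseudoEMetric_complete_countable
    (𝕜 := ℝ) (A := A) ?_ ?_
  · intro x y hxy
    obtain ⟨i, hi⟩ : ∃ i, x.1 i ≠ y.1 i := by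
      by_contra! hc
      exact hxy (Subtype.ext (funext hc))
    refine ⟨_, ⟨polyOnCube (X i), ⟨BoundedContinuousFunction.mkOfCompact (polyOnCube (X i)),
      ⟨X i, rfl⟩, rfl⟩, rfl⟩, ?_⟩
    simpa [polyOnCube] using hi
  · rintro g ⟨p, hp⟩
    have : ∀ x, g x = eval x.1 p := fun x => by
      rw [← polyOnCube_apply]; exact (congrArg (fun f : C(hypercube n, ℝ) => f x) hp).symm
    simpa only [this] using h p

/-! ### Alternating sums as values on edge products -/

/-- The linear functional on polynomials with prescribed values `s γ` on the monomials `X ^ γ`. -/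
noncomputable def momentFunctional {n : ℕ} :
    ((Fin n → ℕ) → ℝ) →ₗ[ℝ] MvPolynomial (Fin n) ℝ →ₗ[ℝ] ℝ :=
  ((basisMonomials (Fin n) ℝ).constr ℝ).toLinearMap ∘ₗ
    LinearMap.funLeft ℝ ℝ (fun m : Fin n →₀ ℕ => (m : Fin n → ℕ))

theorem momentFunctional_prod_X_pow {n : ℕ} (s : (Fin n → ℕ) → ℝ) (γ : Fin n → ℕ) :
    momentFunctional s (∏ i, X i ^ γ i) = s γ := by
  have h : (∏ i, X i ^ γ i : MvPolynomial (Fin n) ℝ) =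
      basisMonomials (Fin n) ℝ (Finsupp.equivFunOnFinite.symm γ) := by
    rw [coe_basisMonomials]
    beta_reduce
    rw [monomial_eq, C_1, one_mul, Finsupp.prod_fintype _ _ (by simp)]
    rfl
  rw [h]
  exact (basisMonomials (Fin n) ℝ).constr_basis ℝ _ _

theorem linearMap_mvPolynomial_ext {n : ℕ} {φ ψ : MvPolynomial (Fin n) ℝ →ₗ[ℝ] ℝ}
    (h : ∀ γ : Fin n → ℕ, φ (∏ i, X i ^ γ i) = ψ (∏ i, X i ^ γ i)) : φ = ψ := by
  refine (basisMonomials (Fin n) ℝ).ext fun m => ?_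
  have hm : basisMonomials (Fin n) ℝ m = ∏ i, X i ^ m i := by
    rw [coe_basisMonomials]
    beta_reduce
    rw [monomial_eq, C_1, one_mul, Finsupp.prod_fintype _ _ (by simp)]
  rw [hm]
  exact h m

/-- The variable `Xᵢ` at the `i`-th odd position and `-Xᵢ` at the `i`-th even position. -/
noncomputable def signedVar {n : ℕ} (k : Fin (2 * n)) : MvPolynomial (Fin n) ℝ :=
  if k.val % 2 = 0 then X ⟨k.val / 2, by omega⟩ else -X ⟨k.val / 2, by omega⟩

@[simp]
theorem signedVar_oddPos {n : ℕ} (i : Fin n) : signedVar (oddPos i) = X i := by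
  simp [signedVar, oddPos]

@[simp]
theorem signedVar_evenPos {n : ℕ} (i : Fin n) : signedVar (evenPos i) = -X i := by
  have h1 : (2 * i.val + 1) % 2 = 1 := by omega
  have h2 : (2 * i.val + 1) / 2 = i.val := by omega
  simp [signedVar, evenPos, h1, h2]

theorem eq_oddPos_or_eq_evenPos {n : ℕ} (k : Fin (2 * n)) :
    ∃ i, k = oddPos i ∨ k = evenPos i := by
  refine ⟨⟨k.val / 2, by omega⟩, ?_⟩
  simp only [oddPos, evenPos, Fin.ext_iff]
  omega

theorem prod_oddPos_mul_evenPos {R : Type*} [CommMonoid R] {n : ℕ} (f : Fin (2 * n) → R) :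
    ∏ k, f k = ∏ i, f (oddPos i) * f (evenPos i) := by
  have hb : Function.Bijective (Sum.elim (oddPos (n := n)) evenPos) := by
    constructor
    · rintro (i | i) (j | j) h <;>
        simp only [Sum.elim_inl, Sum.elim_inr, oddPos, evenPos, Fin.mk.injEq] at h
      · exact congrArg _ (Fin.ext (by omega))
      · omega
      · omega
      · exact congrArg _ (Fin.ext (by omega))
    · intro k
      obtain ⟨i, rfl | rfl⟩ := eq_oddPos_or_eq_evenPos k
      exacts [⟨.inl i, rfl⟩, ⟨.inr i, rfl⟩]
  rw [← hb.prod_comp, Fintype.prod_sum_type, Finset.prod_mul_distrib]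
  rfl

/-- The polynomial `∏ᵢ (1 + Xᵢ) ^ α₂ᵢ₋₁ (1 - Xᵢ) ^ α₂ᵢ`. -/
noncomputable def edgeProduct {n : ℕ} (α : Fin (2 * n) → ℕ) : MvPolynomial (Fin n) ℝ :=
  ∏ k, (1 + signedVar k) ^ α k

/-- Binomial expansion of each factor `(1 + signedVar k) ^ α k`: the signs come from `-Xᵢ` at even
positions, and both positions of a pair contribute powers of the same `Xᵢ`. -/
theorem edgeProduct_eq_sum {n : ℕ} (α : Fin (2 * n) → ℕ) :
    edgeProduct α = ∑ β ∈ Finset.Iic α,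
      ((-1 : ℝ) ^ evenSum β * (multiChoose α β : ℝ)) • ∏ i, X i ^ pairSum β i := by
  have hI : Finset.Iic α = Fintype.piFinset fun k => Finset.range (α k + 1) := by
    ext β
    simp [Pi.le_def]
  simp only [edgeProduct, add_comm (1 : MvPolynomial (Fin n) ℝ), add_pow, one_pow, mul_one]
  rw [Finset.prod_univ_sum, hI]
  refine Finset.sum_congr rfl fun β _ => ?_
  rw [Finset.prod_mul_distrib, prod_oddPos_mul_evenPos fun k => signedVar k ^ β k]
  simp only [signedVar_oddPos, signedVar_evenPos, neg_pow (X _ : MvPolynomial (Fin n) ℝ)]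
  have h : ∀ i : Fin n, (X i ^ β (oddPos i) * ((-1) ^ β (evenPos i) * X i ^ β (evenPos i)) :
      MvPolynomial (Fin n) ℝ) = (-1) ^ β (evenPos i) * X i ^ pairSum β i := fun i => by
    rw [pairSum, pow_add]; ring
  simp only [h]
  rw [Finset.prod_mul_distrib, Finset.prod_pow_eq_pow_sum, smul_eq_C_mul, multiChoose, evenSum]
  simp only [map_mul, map_pow, map_neg, map_one, map_natCast, Nat.cast_prod, map_prod]
  ring

theorem momentFunctional_edgeProduct {n : ℕ} (s : (Fin n → ℕ) → ℝ) (α : Fin (2 * n) → ℕ) :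
    momentFunctional s (edgeProduct α) = ∑ β ∈ Finset.Iic α,
      (-1 : ℝ) ^ evenSum β * (multiChoose α β : ℝ) * s (pairSum β) := by
  rw [edgeProduct_eq_sum, map_sum]
  refine Finset.sum_congr rfl fun β _ => ?_
  rw [map_smul, momentFunctional_prod_X_pow, smul_eq_mul]

theorem eval_edgeProduct_nonneg {n : ℕ} (α : Fin (2 * n) → ℕ) {x : Fin n → ℝ}
    (hx : x ∈ hypercube n) : 0 ≤ eval x (edgeProduct α) := by
  rw [edgeProduct, map_prod]
  refine Finset.prod_nonneg fun k _ => ?_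
  rw [map_pow]
  refine pow_nonneg ?_ _
  obtain ⟨i, rfl | rfl⟩ := eq_oddPos_or_eq_evenPos k
  · have := (hx i).1
    simp; linarith
  · have := (hx i).2
    simp; linarith

theorem exists_smul_edgeProduct_of_mem_bernsteinMonoid {n : ℕ} {m : MvPolynomial (Fin n) ℝ}
    (hm : m ∈ bernsteinMonoid n) : ∃ c : ℝ, 0 ≤ c ∧ ∃ α, m = c • edgeProduct α := by
  have hsingle : ∀ k : Fin (2 * n), edgeProduct (Pi.single k 1) = 1 + signedVar k := fun k => by
    rw [edgeProduct, Finset.prod_eq_single k]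
    · simp
    · intro j _ hj
      simp [hj]
    · simp
  induction hm using Submonoid.closure_induction with
  | mem g hg =>
    obtain ⟨i, rfl | rfl⟩ := hg
    · exact ⟨1 / 2, by norm_num, Pi.single (oddPos i) 1, by
        rw [hsingle, signedVar_oddPos, smul_eq_C_mul]⟩
    · exact ⟨1 / 2, by norm_num, Pi.single (evenPos i) 1, by
        rw [hsingle, signedVar_evenPos, smul_eq_C_mul, sub_eq_add_neg]⟩
  | one => exact ⟨1, zero_le_one, 0, by simp [edgeProduct]⟩
  | mul x y _ _ hx hy =>
    obtain ⟨c, hc, α, rfl⟩ := hx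
    obtain ⟨d, hd, β, rfl⟩ := hy
    refine ⟨c * d, mul_nonneg hc hd, α + β, ?_⟩
    rw [smul_mul_smul_comm]
    simp [edgeProduct, pow_add, Finset.prod_mul_distrib]

theorem momentFunctional_nonneg_of_edgeProduct {n : ℕ} {s : (Fin n → ℕ) → ℝ}
    (h : ∀ α, 0 ≤ momentFunctional s (edgeProduct α)) {m : MvPolynomial (Fin n) ℝ}
    (hm : m ∈ bernsteinMonoid n) : 0 ≤ momentFunctional s m := by
  obtain ⟨c, hc, α, rfl⟩ := exists_smul_edgeProduct_of_mem_bernsteinMonoid hm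
  rw [map_smul]
  exact mul_nonneg hc (h α)

/-! ### Integration of polynomials against signed measures -/

theorem isFiniteMeasure_variation {X : Type*} [MeasurableSpace X] (τ : SignedMeasure X) :
    IsFiniteMeasure τ.variation := by
  rw [← SignedMeasure.totalVariation_eq_variation, SignedMeasure.totalVariation]
  infer_instance

theorem signedMeasure_integrable_eval {n : ℕ} (τ : SignedMeasure (hypercube n))
    (p : MvPolynomial (Fin n) ℝ) : τ.Integrable fun x : hypercube n => eval x.1 p :=
  have := isFiniteMeasure_variation τ
  integrable_eval_hypercube _ p

/-- The Jordan parts of `τ - τ'` have equal polynomial integrals, so they coincide as measures. -/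
theorem signedMeasure_hypercube_ext {n : ℕ} {τ τ' : SignedMeasure (hypercube n)}
    (h : ∀ p : MvPolynomial (Fin n) ℝ,
      ∫ᵛ x, eval x.1 p ∂<•τ = ∫ᵛ x, eval x.1 p ∂<•τ') : τ = τ' := by
  rw [← sub_eq_zero]
  set ρ := τ - τ' with hρ
  have hρ0 : ∀ p : MvPolynomial (Fin n) ℝ, ∫ᵛ x, eval x.1 p ∂<•ρ = 0 := fun p => by
    rw [hρ, VectorMeasure.integral_sub_vectorMeasure (signedMeasure_integrable_eval _ p)
      (signedMeasure_integrable_eval _ p), h, sub_self]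
  have hJ : ρ = ρ.toJordanDecomposition.posPart.toSignedMeasure -
      ρ.toJordanDecomposition.negPart.toSignedMeasure :=
    (SignedMeasure.toSignedMeasure_toJordanDecomposition ρ).symm
  have heq : ρ.toJordanDecomposition.posPart = ρ.toJordanDecomposition.negPart := by
    refine measure_hypercube_ext fun p => ?_
    have := hρ0 p
    rw [hJ, VectorMeasure.integral_sub_vectorMeasure (signedMeasure_integrable_eval _ p)
      (signedMeasure_integrable_eval _ p), VectorMeasure.integral_toSignedMeasure,
      VectorMeasure.integral_toSignedMeasure] at this
    linarith
  rw [hJ]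
  ext A hA
  simp [heq]

theorem signedMeasure_integral_nonneg {X : Type*} [MeasurableSpace X] {τ : SignedMeasure X}
    (hτ : ∀ A, MeasurableSet A → 0 ≤ τ A) {K : Set X} (hK : MeasurableSet K) (hK0 : τ Kᶜ = 0)
    {f : X → ℝ} (hf : ∀ x ∈ K, 0 ≤ f x) : 0 ≤ ∫ᵛ x, f x ∂<•τ := by
  have h0 : 0 ≤[Set.univ] τ := by
    rw [VectorMeasure.le_restrict_univ_iff_le, VectorMeasure.le_iff]
    exact hτ
  rw [← SignedMeasure.toMeasureOfZeroLE_toSignedMeasure τ h0,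
    VectorMeasure.integral_toSignedMeasure]
  refine integral_nonneg_of_ae ?_
  have hae : ∀ᵐ x ∂(τ.toMeasureOfZeroLE Set.univ MeasurableSet.univ h0), x ∈ K := by
    rw [ae_iff]
    change τ.toMeasureOfZeroLE Set.univ MeasurableSet.univ h0 Kᶜ = 0
    rw [SignedMeasure.toMeasureOfZeroLE_apply _ _ _ hK.compl]
    simp [hK0]
  exact hae.mono hf

theorem integral_eval_eq_momentFunctional {n : ℕ} {τ : SignedMeasure (Fin n → ℝ)}
    (hτ : ∀ γ : Fin n → ℕ, τ.Integrable fun x => ∏ i, x i ^ γ i)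
    (p : MvPolynomial (Fin n) ℝ) :
    (τ.Integrable fun x => eval x p) ∧ ∫ᵛ x, eval x p ∂<•τ =
      momentFunctional (fun γ => ∫ᵛ x, ∏ i, x i ^ γ i ∂<•τ) p := by
  have hint : ∀ q : MvPolynomial (Fin n) ℝ, τ.Integrable fun x => eval x q := fun q => by
    induction q using MvPolynomial.induction_on' with
    | monomial m a =>
      simp only [eval_monomial, Finsupp.prod_fintype _ _ (fun _ => pow_zero _)]
      exact (hτ m).const_mul a
    | add p q hp hq =>
      simp only [map_add]
      exact hp.add hq
  refine ⟨hint p, ?_⟩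
  let φ : MvPolynomial (Fin n) ℝ →ₗ[ℝ] ℝ :=
    { toFun := fun q => ∫ᵛ x, eval x q ∂<•τ
      map_add' := fun q r => by
        simp only [map_add]
        exact VectorMeasure.integral_fun_add (hint q) (hint r)
      map_smul' := fun c q => by
        simp only [smul_eval]
        exact VectorMeasure.integral_fun_smul τ _ c fun x => eval x q }
  have : φ = momentFunctional fun γ => ∫ᵛ x, ∏ i, x i ^ γ i ∂<•τ := by
    refine linearMap_mvPolynomial_ext fun γ => ?_
    rw [momentFunctional_prod_X_pow]
    simp [φ]
  exact LinearMap.congr_fun this p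

theorem isClosed_hypercube (n : ℕ) : IsClosed (hypercube n) :=
  (isCompact_iff_compactSpace.2 inferInstance).isClosed

/-! ### Necessity -/

theorem trace_mul_eq_sum {t : ℕ} (G M : Matrix (Fin t) (Fin t) ℝ) :
    (G * M).trace = ∑ i, ∑ j, G i j * M j i := by
  simp [Matrix.trace, Matrix.mul_apply]

/-- Writing `G` as a sum of matrices `a aᵀ` turns the trace into a sum of values `aᵀ M a`. -/
theorem trace_mul_nonneg {t : ℕ} {G M : Matrix (Fin t) (Fin t) ℝ} (hG : G.PosSemidef)
    (hM : ∀ v : Fin t → ℝ, 0 ≤ v ⬝ᵥ (M *ᵥ v)) : 0 ≤ (G * M).trace := by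
  obtain ⟨m, A, rfl⟩ := Matrix.posSemidef_iff_eq_sum_vecMulVec.mp hG
  rw [Finset.sum_mul, Matrix.trace_sum]
  refine Finset.sum_nonneg fun k _ => ?_
  rw [Matrix.trace_mul_comm, Matrix.mul_vecMulVec, Matrix.trace_vecMulVec, dotProduct_comm]
  simpa using hM (A k)

theorem momentFunctional_edgeProduct_nonneg_of_isMatrixMomentSequence {n t : ℕ}
    {S : (Fin n → ℕ) → Matrix (Fin t) (Fin t) ℝ} (h : IsMatrixMomentSequence (hypercube n) S)
    {G : Matrix (Fin t) (Fin t) ℝ} (hG : G.PosDef) (α : Fin (2 * n) → ℕ) :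
    0 ≤ momentFunctional (fun γ => (G * S γ).trace) (edgeProduct α) := by
  obtain ⟨E, ⟨-, hpos⟩, hsupp, hmom⟩ := h
  -- The scalar measure `tr (G E)`; it is nonnegative and vanishes off the cube.
  set τ : SignedMeasure (Fin n → ℝ) := ∑ i, ∑ j, G i j • E j i with hτ
  have hτA : ∀ A, τ A = (G * E.value A).trace := fun A => by
    simp [hτ, trace_mul_eq_sum, MatrixMeasure.value]
  have hint : ∀ γ : Fin n → ℕ, ∀ i j,
      (G i j • E j i).Integrable fun x : Fin n → ℝ => ∏ k, x k ^ γ k := fun γ i j =>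
    ((hmom γ).1 j i).smul_vectorMeasure _
  have hS : (fun γ => (G * S γ).trace) = fun γ => ∫ᵛ x, ∏ i, x i ^ γ i ∂<•τ := by
    funext γ
    rw [hτ, VectorMeasure.integral_finsetSum_vectorMeasure fun i _ =>
      VectorMeasure.Integrable.finsetSum_vectorMeasure fun j _ => hint γ i j, trace_mul_eq_sum]
    refine Finset.sum_congr rfl fun i _ => ?_
    rw [VectorMeasure.integral_finsetSum_vectorMeasure fun j _ => hint γ i j]
    refine Finset.sum_congr rfl fun j _ => ?_
    rw [VectorMeasure.integral_smul_vectorMeasure, (hmom γ).2]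
    rfl
  have hE0 : ∀ i j, E i j (hypercube n)ᶜ = 0 := fun i j => by
    have h0 : (E i j).variation (hypercube n)ᶜ = 0 :=
      measure_mono_null (Set.compl_subset_compl.2 <|
        (Set.subset_iUnion₂ (s := fun i j => (E i j).variation.support) i j).trans hsupp)
        Measure.measure_compl_support
    have := VectorMeasure.enorm_measure_le_variation (E i j) (hypercube n)ᶜ
    simpa [h0] using this
  rw [hS, ← (integral_eval_eq_momentFunctional (fun γ =>
    VectorMeasure.Integrable.finsetSum_vectorMeasure fun i _ =>
      VectorMeasure.Integrable.finsetSum_vectorMeasure fun j _ => hint γ i j) _).2]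
  refine signedMeasure_integral_nonneg (fun A hA => ?_) (isClosed_hypercube n).measurableSet ?_
    fun x hx => eval_edgeProduct_nonneg α hx
  · rw [hτA]
    exact trace_mul_nonneg hG.posSemidef (hpos A hA)
  · rw [hτA, trace_mul_eq_sum]
    simp [MatrixMeasure.value, hE0]

/-! ### Sufficiency -/

theorem dotProduct_mulVec_eq_trace {t : ℕ} (M : Matrix (Fin t) (Fin t) ℝ) (v : Fin t → ℝ) :
    v ⬝ᵥ (M *ᵥ v) = (Matrix.vecMulVec v v * M).trace := by
  rw [Matrix.trace_mul_comm, Matrix.mul_vecMulVec, Matrix.trace_vecMulVec, dotProduct_comm]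

theorem dotProduct_mulVec_eq_sum {t : ℕ} (M : Matrix (Fin t) (Fin t) ℝ) (v : Fin t → ℝ) :
    v ⬝ᵥ (M *ᵥ v) = ∑ i, ∑ j, (v i * v j) * M i j := by
  simp only [dotProduct, Matrix.mulVec, Finset.mul_sum]
  exact Finset.sum_congr rfl fun i _ => Finset.sum_congr rfl fun j _ => by ring

/-- The matrix `v vᵀ` is only semidefinite, so the hypothesis is applied to `v vᵀ + ε I` and `ε`
tends to `0` from above. -/
theorem momentFunctional_quadraticForm_nonneg {n t : ℕ}
    {S : (Fin n → ℕ) → Matrix (Fin t) (Fin t) ℝ}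
    (h : ∀ G : Matrix (Fin t) (Fin t) ℝ, G.PosDef → ∀ α : Fin (2 * n) → ℕ,
      0 ≤ momentFunctional (fun γ => (G * S γ).trace) (edgeProduct α))
    (v : Fin t → ℝ) {m : MvPolynomial (Fin n) ℝ} (hm : m ∈ bernsteinMonoid n) :
    0 ≤ momentFunctional (fun γ => v ⬝ᵥ (S γ *ᵥ v)) m := by
  have hε : ∀ ε : ℝ, 0 < ε → 0 ≤ momentFunctional (fun γ => v ⬝ᵥ (S γ *ᵥ v)) m +
      ε * momentFunctional (fun γ => (S γ).trace) m := fun ε hε => by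
    have hG : (Matrix.vecMulVec v v + ε • (1 : Matrix (Fin t) (Fin t) ℝ)).PosDef := by
      refine Matrix.PosDef.posSemidef_add ?_ (Matrix.PosDef.one.smul hε)
      simpa using Matrix.posSemidef_vecMulVec_self_star v
    have := momentFunctional_nonneg_of_edgeProduct (h _ hG) hm
    have hs : (fun γ => ((Matrix.vecMulVec v v + ε • (1 : Matrix (Fin t) (Fin t) ℝ)) *
        S γ).trace) = (fun γ => v ⬝ᵥ (S γ *ᵥ v)) + ε • fun γ => (S γ).trace := by
      funext γ
      simp [add_mul, dotProduct_mulVec_eq_trace]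
    rwa [hs, map_add, map_smul] at this
  have hlim : Filter.Tendsto (fun ε : ℝ => momentFunctional (fun γ => v ⬝ᵥ (S γ *ᵥ v)) m +
      ε * momentFunctional (fun γ => (S γ).trace) m) (nhdsWithin 0 (Set.Ioi 0))
      (nhds (momentFunctional (fun γ => v ⬝ᵥ (S γ *ᵥ v)) m)) := by
    refine tendsto_nhdsWithin_of_tendsto_nhds ?_
    refine (Continuous.tendsto' (by fun_prop) _ _ (by simp))
  exact ge_of_tendsto hlim (Filter.eventually_of_mem self_mem_nhdsWithin hε)

theorem polarization_apply_single {t : ℕ} {M : Matrix (Fin t) (Fin t) ℝ} (hM : M.IsSymm)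
    (i j : Fin t) :
    (1 / 4 : ℝ) * ((Pi.single i 1 + Pi.single j 1) ⬝ᵥ (M *ᵥ (Pi.single i 1 + Pi.single j 1)) -
      (Pi.single i 1 - Pi.single j 1) ⬝ᵥ (M *ᵥ (Pi.single i 1 - Pi.single j 1))) = M i j := by
  have := hM.apply i j
  simp [Matrix.mulVec_add, Matrix.mulVec_sub]
  linarith

theorem isMatrixMomentSequence_of_edgeProduct_nonneg {n t : ℕ}
    {S : (Fin n → ℕ) → Matrix (Fin t) (Fin t) ℝ} (hS : ∀ γ, (S γ).IsSymm)
    (h : ∀ G : Matrix (Fin t) (Fin t) ℝ, G.PosDef → ∀ α : Fin (2 * n) → ℕ,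
      0 ≤ momentFunctional (fun γ => (G * S γ).trace) (edgeProduct α)) :
    IsMatrixMomentSequence (hypercube n) S := by
  choose μ hμf hμ using fun v : Fin t → ℝ => exists_measure_of_nonneg_on_bernsteinMonoid
    (momentFunctional fun γ => v ⬝ᵥ (S γ *ᵥ v))
    fun m hm => momentFunctional_quadraticForm_nonneg h v hm
  -- Polarization: the measures for `eᵢ + eⱼ` and `eᵢ - eⱼ` recover the entry `(i, j)` because each
  -- `S γ` is symmetric.
  let τ : Fin t → Fin t → SignedMeasure (hypercube n) := fun i j =>
    (1 / 4 : ℝ) • ((μ (Pi.single i 1 + Pi.single j 1)).toSignedMeasure -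
      (μ (Pi.single i 1 - Pi.single j 1)).toSignedMeasure)
  have hτ : ∀ i j p, ∫ᵛ x, eval x.1 p ∂<•(τ i j) = momentFunctional (fun γ => S γ i j) p := by
    intro i j p
    rw [VectorMeasure.integral_smul_vectorMeasure, VectorMeasure.integral_sub_vectorMeasure
      (signedMeasure_integrable_eval _ p) (signedMeasure_integrable_eval _ p),
      VectorMeasure.integral_toSignedMeasure, VectorMeasure.integral_toSignedMeasure,
      ← hμ, ← hμ, ← LinearMap.sub_apply, ← map_sub, ← LinearMap.smul_apply, ← map_smul]
    congr 2
    funext γ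
    exact polarization_apply_single (hS γ) i j
  have hsymm : ∀ i j, τ i j = τ j i := fun i j => by
    refine signedMeasure_hypercube_ext fun p => ?_
    rw [hτ, hτ]
    congr 2
    funext γ
    exact (hS γ).apply j i
  -- The measures `μ v` were chosen independently for each `v`; uniqueness makes them depend
  -- quadratically on `v`, since their moments do.
  have hquad : ∀ v : Fin t → ℝ, ∑ i, ∑ j, (v i * v j) • τ i j = (μ v).toSignedMeasure := by
    intro v
    refine signedMeasure_hypercube_ext fun p => ?_
    rw [VectorMeasure.integral_toSignedMeasure, ← hμ,
      VectorMeasure.integral_finsetSum_vectorMeasure fun i _ => signedMeasure_integrable_eval _ p]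
    have hs : (fun γ => v ⬝ᵥ (S γ *ᵥ v)) =
        ∑ i, ∑ j, (v i * v j) • fun γ => S γ i j := by
      funext γ
      simp [dotProduct_mulVec_eq_sum]
    rw [hs, map_sum, LinearMap.sum_apply]
    refine Finset.sum_congr rfl fun i _ => ?_
    rw [VectorMeasure.integral_finsetSum_vectorMeasure fun i _ =>
      signedMeasure_integrable_eval _ p, map_sum, LinearMap.sum_apply]
    refine Finset.sum_congr rfl fun j _ => ?_
    rw [VectorMeasure.integral_smul_vectorMeasure, hτ, map_smul, LinearMap.smul_apply]
  have hemb : MeasurableEmbedding (Subtype.val : hypercube n → Fin n → ℝ) :=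
    MeasurableEmbedding.subtype_coe (isClosed_hypercube n).measurableSet
  have hmono : ∀ γ : Fin n → ℕ, (fun x : hypercube n => ∏ i, x.1 i ^ γ i) =
      fun x => eval x.1 (∏ i, X i ^ γ i) := fun γ => by simp
  refine ⟨fun i j => (τ i j).map Subtype.val,
    ⟨fun i j => congrArg (·.map Subtype.val) (hsymm i j), fun A hA v => ?_⟩, ?_,
    fun γ => ⟨fun i j => ?_, ?_⟩⟩
  · have hv := congrArg (fun ρ : SignedMeasure (hypercube n) => ρ (Subtype.val ⁻¹' A)) (hquad v)
    have hA' : MeasurableSet (Subtype.val ⁻¹' A : Set (hypercube n)) :=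
      hemb.measurable hA
    simp only [Measure.toSignedMeasure_apply_measurable hA'] at hv
    rw [dotProduct_mulVec_eq_sum]
    have : ∑ i, ∑ j, (v i * v j) * (τ i j) (Subtype.val ⁻¹' A) =
        (μ v).real (Subtype.val ⁻¹' A) := by
      rw [← hv]
      simp
    simp only [MatrixMeasure.value, Matrix.of_apply, VectorMeasure.map_apply _ hemb.measurable hA]
    rw [this]
    exact measureReal_nonneg
  · refine Set.iUnion_subset fun i => Set.iUnion_subset fun j => ?_
    refine Measure.support_subset_of_isClosed (isClosed_hypercube n) ?_
    rw [mem_ae_iff, hemb.variation_map,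
      Measure.map_apply hemb.measurable (isClosed_hypercube n).measurableSet.compl]
    convert measure_empty (μ := (τ i j).variation)
    ext x
    simp
  · refine hemb.integrable_map_vectorMeasure.2 ?_
    change (τ i j).Integrable fun x : hypercube n => ∏ i, x.1 i ^ γ i
    rw [hmono]
    exact signedMeasure_integrable_eval _ _
  · ext i j
    simp only [MatrixMeasure.integral, Matrix.of_apply]
    rw [hemb.integral_map_vectorMeasure, hmono, hτ, momentFunctional_prod_X_pow]

theorem mainTheorem2 (n t : ℕ) (S : (Fin n → ℕ) → Matrix (Fin t) (Fin t) ℝ)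
    (hS : ∀ α, (S α).IsSymm) :
    IsMatrixMomentSequence (hypercube n) S ↔
      ∀ G : Matrix (Fin t) (Fin t) ℝ, G.PosDef → ∀ α : Fin (2 * n) → ℕ,
        0 ≤ ∑ β ∈ Finset.Iic α,
          (-1 : ℝ) ^ evenSum β * (multiChoose α β : ℝ) * (G * S (pairSum β)).trace := by
  refine ⟨fun h G hG α => ?_, fun h => ?_⟩
  · rw [← momentFunctional_edgeProduct fun γ => (G * S γ).trace]
    exact momentFunctional_edgeProduct_nonneg_of_isMatrixMomentSequence h hG α
  · refine isMatrixMomentSequence_of_edgeProduct_nonneg hS fun G hG α => ?_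
    rw [momentFunctional_edgeProduct]
    exact h G hG α
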